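/- Let $k$ and $r$ be positive integers with $r<k$, write $[n]=\{1,\dots,n\}$, and let $p=(p_1,\dots,p_k)$ be a tuple of non-negative integers. For an integer $s\ge 0$ and a tuple $q=(q_1,\dots,q_k)$ of integers, let $\mathcal{M}_{q,s}$ be the set of $s$-tuples $(S_1,\dots,S_s)$ of proper subsets of $[k]$ such that each $j\in[k]$ belongs to exactly $q_j$ of the sets $S_1,\dots,S_s$ (so $\mathcal{M}_{q,s}=\emptyset$ if some $q_j<0$). Consider elements of $[k]$ cyclically modulo $k$, and for $i,j\in[k]$ let $]i,j]=\{i+1,i+2,\dots,j\}$, so that $]i,i]=\emptyset$ and $]i,i-1]=[k]\setminus\{i\}$. For $i\in[k]$ and $S\subseteq[k]$ define $\alpha(i,S)=\beta(i,S)=\gamma(i,S)=i$ if $S=[k]$, and for $S\neq[k]$: - $\alpha(i,S)$ is the unique $j\in[k]$ such that $j\notin S$ and $]i,j-1]\subseteq S$; - $\beta(i,S)$ is the unique $j\in[k]$ such that $j+1\notin S$ and $]i,j]\subseteq S$; - $\gamma(i,S)=i-1$ if $i\in S$, and $\gamma(i,S)=\beta(i,S)$ if $i\notin S$. For $\zeta\in\{\alpha,\beta,\gamma\}$,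 a tuple $\mathbf S=(S_1,\dots,S_r)$ of subsets of $[k]$ and a map $\varphi:[k-1]\to[r]$, let $G_\zeta(\mathbf S,\varphi)$ be the digraph with vertex set $[k]$ and arcs $(i,\zeta(i,S_{\varphi(i)}))$ for $i\in[k-1]$. A digraph is called a tree if the undirected multigraph obtained by forgetting the orientation of its arcs is a tree (in particular there are no loops and no pairs of opposite arcs). **Theorem 1.** Suppose that $\mathcal{M}_{p,r}$ is non-empty. Let $\mathbf S=(S_1,\dots,S_r)$ be a uniformly random element of $\mathcal{M}_{p,r}$, and let $\varphi$ be a uniformly random surjection from $[k-1]$ to $[r]$, independent of $\mathbf S$. Let $P_\zeta(p,r)$ be the probability that the random digraph $G_\zeta(\mathbf S,\varphi)$ is a tree. For $j\in[k]$ let $q^{(j)}=(q^{(j)}_1,\dots,q^{(j)}_k)$, where $q^{(j)}_i=p_i-1$ if $i\ne j$ and $q^{(j)}_j=p_j$. Then (a) $P_\alpha(p,r)=1-p_k/r$, and this is equal to the probability that $k\notin S_1$. (b) $P_\beta(p,r)=|\mathcal{M}_{q,r-1}|/|\mathcal{M}_{p,r}|$, where $q=q^{(1)}=(p_1,p_2-1,p_3-1,\dots,p_k-1)$,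 and this is equal to the probability that $S_1=\{2,3,\dots,k\}$. (c) $P_\gamma(p,r)=\sum_{j=1}^k|\mathcal{M}_{q^{(j)},r-1}|/|\mathcal{M}_{p,r}|$, and this is equal to the probability that $|S_1|=k-1$. -/

import Mathlib

open MeasureTheory ProbabilityTheory

/-- The set `[k] = {1, …, k}` is modelled by `Fin k`: the integer `j ∈ [k]` is the element of
`Fin k` of value `j - 1`, and addition in `Fin k` is addition of integers modulo `k`.
`cycIoc i j` is the cyclic interval `]i, j] = {i + 1, i + 2, …, j}` (modulo `k`), so that
`]i, i] = ∅` and `]i, i - 1] = [k] \ {i}`. -/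
def cycIoc {k : ℕ} [NeZero k] (i j : Fin k) : Finset (Fin k) :=
  Finset.univ.filter fun x => 0 < (x - i).val ∧ (x - i).val ≤ (j - i).val

theorem existsUnique_alpha {k : ℕ} [NeZero k] (i : Fin k) (S : Finset (Fin k))
    (hS : S ≠ Finset.univ) : ∃! j : Fin k, j ∉ S ∧ cycIoc i (j - 1) ⊆ S := by
  obtain ⟨m, rfl⟩ : ∃ m, k = m + 1 := ⟨k - 1, by have := NeZero.pos k; omega⟩
  have key : ∀ x : Fin (m + 1), x ≠ 0 → (x - 1).val = x.val - 1 := fun x hx =>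
    Fin.val_sub_one_of_ne_zero hx
  have sub_i : ∀ x : Fin (m + 1), x - (i + 1) = (x - i) - 1 := fun x => by abel
  have sub_j : ∀ x : Fin (m + 1), x - 1 - i = (x - i) - 1 := fun x => by abel
  have val_pos : ∀ x : Fin (m + 1), x ≠ 0 → 0 < x.val := fun x hx => Fin.val_pos_iff.2
    (Fin.pos_iff_ne_zero.2 hx)
  have hne : (Finset.univ.filter fun j => j ∉ S).Nonempty := by
    by_contra h
    rw [Finset.not_nonempty_iff_eq_empty, Finset.filter_eq_empty_iff] at h
    exact hS (Finset.eq_univ_iff_forall.2 fun x => not_not.1 (h (Finset.mem_univ x)))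
  obtain ⟨j, hj, hmin⟩ := Finset.exists_min_image _ (fun j => (j - (i + 1)).val) hne
  rw [Finset.mem_filter] at hj
  refine ⟨j, ⟨hj.2, ?_⟩, ?_⟩
  · intro x hx
    by_contra hxS
    have h1 := hmin x (by simp [hxS])
    simp only [cycIoc, Finset.mem_filter, Finset.mem_univ, true_and] at hx
    have hx0 : x - i ≠ 0 := by intro h; rw [h] at hx; simp at hx
    simp only [sub_i, key _ hx0] at h1
    rw [sub_j] at hx
    omega
  · rintro j' ⟨hj', hsub⟩
    have h1 := hmin j' (by simp [hj'])
    by_contra hne'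
    have hlt : (j - i - 1).val < (j' - i - 1).val := by
      simp only [sub_i] at h1
      refine lt_of_le_of_ne h1 fun h => hne' ?_
      have := Fin.ext h
      simpa using this.symm
    have hj0 : j - i ≠ 0 := by
      intro h
      rw [h] at hlt
      have h2 : ((0 : Fin (m + 1)) - 1).val = m := by simp
      have := (j' - i - 1).isLt
      omega
    refine hj.2 (hsub ?_)
    simp only [cycIoc, Finset.mem_filter, Finset.mem_univ, true_and, sub_j]
    have := key _ hj0
    have := val_pos _ hj0
    omega

theorem existsUnique_beta {k : ℕ} [NeZero k] (i : Fin k) (S : Finset (Fin k))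
    (hS : S ≠ Finset.univ) : ∃! j : Fin k, j + 1 ∉ S ∧ cycIoc i j ⊆ S := by
  obtain ⟨j, ⟨h1, h2⟩, h3⟩ := existsUnique_alpha i S hS
  refine ⟨j - 1, ⟨by simpa using h1, h2⟩, fun j' hj' => ?_⟩
  have := h3 (j' + 1) ⟨hj'.1, by simpa using hj'.2⟩
  simp [← this]

/-- `α(i, S) = i` if `S = [k]`; otherwise the `j` with `j ∉ S` and `]i, j - 1] ⊆ S`. -/
def alphaMap {k : ℕ} [NeZero k] (i : Fin k) (S : Finset (Fin k)) : Fin k :=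
  if hS : S = Finset.univ then i else
    Fintype.choose (fun j : Fin k => j ∉ S ∧ cycIoc i (j - 1) ⊆ S) (existsUnique_alpha i S hS)

/-- `β(i, S) = i` if `S = [k]`; otherwise the `j` with `j + 1 ∉ S` and `]i, j] ⊆ S`. -/
def betaMap {k : ℕ} [NeZero k] (i : Fin k) (S : Finset (Fin k)) : Fin k :=
  if hS : S = Finset.univ then i else
    Fintype.choose (fun j : Fin k => j + 1 ∉ S ∧ cycIoc i j ⊆ S) (existsUnique_beta i S hS)

/-- `γ(i, S) = i` if `S = [k]`, `γ(i, S) = i - 1` (modulo `k`) if `i ∈ S ≠ [k]`; otherwise the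
`j` with `j + 1 ∉ S` and `]i, j] ⊆ S`. -/
def gammaMap {k : ℕ} [NeZero k] (i : Fin k) (S : Finset (Fin k)) : Fin k :=
  if hS : S = Finset.univ then i else if i ∈ S then i - 1 else
    Fintype.choose (fun j : Fin k => j + 1 ∉ S ∧ cycIoc i j ⊆ S) (existsUnique_beta i S hS)

/-- The set of `r`-tuples of subsets of `[k]` in which each `j ∈ [k]` lies in exactly `p_j` of the
subsets (the empty set if some `p_j` is negative). -/
def tuplesS {k : ℕ} (p : Fin k → ℤ) (r : ℕ) : Finset (Fin r → Finset (Fin k)) :=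
  Finset.univ.filter fun S =>
    ∀ j : Fin k, ((Finset.univ.filter fun t : Fin r => j ∈ S t).card : ℤ) = p j

/-- The tuples in `tuplesS p r` consisting of proper subsets of `[k]`. -/
def tuplesM {k : ℕ} (p : Fin k → ℤ) (r : ℕ) : Finset (Fin r → Finset (Fin k)) :=
  (tuplesS p r).filter fun S => ∀ t : Fin r, S t ≠ Finset.univ

/-- The multiplicities `q⁽ʲ⁾`: `p_i - 1` for `i ≠ j`, and `p_j` for `i = j`. -/
def decreaseExcept {k : ℕ} (p : Fin k → ℤ) (j : Fin k) : Fin k → ℤ :=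
  fun i => if i = j then p i else p i - 1

/-- The inclusion of `[k - 1]` in `[k]`. -/
def inclVertex {k : ℕ} (i : Fin (k - 1)) : Fin k := Fin.castLE (Nat.sub_le k 1) i

/-- The element `k` of `[k]`. -/
def lastVertex (k : ℕ) [NeZero k] : Fin k := ⟨k - 1, Nat.sub_lt (NeZero.pos k) one_pos⟩

/-- The digraph with vertex set `[k]` whose arcs are the pairs `(i, ζ(i, S_{φ(i)}))`,
for `i ∈ [k - 1]`. -/
def arcDigraph {k r : ℕ} (ζ : Fin k → Finset (Fin k) → Fin k) (S : Fin r → Finset (Fin k))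
    (φ : Fin (k - 1) → Fin r) : Digraph (Fin k) where
  Adj u v := ∃ i : Fin (k - 1), u = inclVertex i ∧ v = ζ (inclVertex i) (S (φ i))

/-- A digraph is a tree if the undirected multigraph obtained by forgetting the orientation of its
arcs is a tree: there are no loops, no pairs of opposite arcs (these would be cycles of length
one and two), and the underlying simple graph is a tree. -/
def IsDirectedTree {V : Type*} (G : Digraph V) : Prop :=
  (∀ v, ¬ G.Adj v v) ∧ (∀ u v, G.Adj u v → ¬ G.Adj v u) ∧ G.toSimpleGraphInclusive.IsTree

/-! Every vertex except `k` has exactly one out-arc, so the digraph is a tree iff every forward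
orbit ends at `k` (`isDirectedTree_arcDigraph_iff`), and the reduced Laplacian with rows `e_i -
e_{ζ(i, S_{φ(i)})}` has determinant 1 or 0 accordingly (`det_laplacian`).

The heart is that, for fixed multiplicities `p`, the number of tuples giving a tree is the same for
every `φ` (`card_isDirectedTree_eq`). For each of the three maps, the row of `i` is an affine
function of the solution of the cyclic system `t_l = 1_{l ∈ S} (c_l + t_{l+1})`. Put one copy of
this system for each set into a large matrix, with the indicators replaced by free parameters. Its
determinant is affine in each parameter, hence is a weighted sum of its values at 0/1 points
(`eq_sum_of_affine_update`). At tuples of proper sets these values are the tree indicators; they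
vanish once some set is all of `[k]`, because the `c_l` sum to zero. If the parameters are the same
in all copies, so are the solutions, and `φ` drops out (`sum_weight_mul_det_eq`). Comparing
coefficients as the parameters vary isolates each `p` (`sum_tuplesS_eq_zero`).

One may therefore take `φ` constant, so that only `S_1` governs the digraph. A tree then means `k ∉
S_1` for `α`, `S_1 = {2, …, k}` for `β`, and `|S_1| = k - 1` for `γ`; these events are counted
directly. -/

/-! ### Functional digraphs rooted at `k` -/

section Functional

variable {k : ℕ}

theorem inclVertex_injective : Function.Injective (inclVertex (k := k)) :=
  Fin.castLE_injective (Nat.sub_le k 1)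

/-- A map `[k - 1] → [k]`, extended to `[k]` by fixing `k`. -/
def extendMap (f : Fin (k - 1) → Fin k) (v : Fin k) : Fin k :=
  if h : v.val < k - 1 then f ⟨v.val, h⟩ else v

theorem extendMap_inclVertex (f : Fin (k - 1) → Fin k) (i : Fin (k - 1)) :
    extendMap f (inclVertex i) = f i := by
  simp [extendMap, inclVertex]

variable [NeZero k]

theorem inclVertex_ne_lastVertex (i : Fin (k - 1)) : inclVertex i ≠ lastVertex k := by
  intro h
  have := congrArg Fin.val h
  simp only [inclVertex, lastVertex, Fin.val_castLE] at this
  omega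

theorem exists_inclVertex_of_ne_lastVertex {v : Fin k} (h : v ≠ lastVertex k) :
    ∃ i : Fin (k - 1), inclVertex i = v := by
  have hv : v.val ≠ k - 1 := fun h' => h (Fin.ext h')
  exact ⟨⟨v.val, by omega⟩, rfl⟩

theorem extendMap_lastVertex (f : Fin (k - 1) → Fin k) :
    extendMap f (lastVertex k) = lastVertex k := by
  simp [extendMap, lastVertex]

/-- The forward orbit of `v` under `f` ends at the last vertex. -/
def ReachesLast (f : Fin (k - 1) → Fin k) (v : Fin k) : Prop :=
  ∃ n, (extendMap f)^[n] v = lastVertex k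

theorem reachesLast_lastVertex (f : Fin (k - 1) → Fin k) : ReachesLast f (lastVertex k) :=
  ⟨0, rfl⟩

theorem reachesLast_inclVertex_iff (f : Fin (k - 1) → Fin k) (i : Fin (k - 1)) :
    ReachesLast f (inclVertex i) ↔ ReachesLast f (f i) := by
  constructor
  · rintro ⟨n, hn⟩
    cases n with
    | zero => exact absurd hn (inclVertex_ne_lastVertex i)
    | succ n =>
      rw [Function.iterate_succ_apply, extendMap_inclVertex] at hn
      exact ⟨n, hn⟩
  · rintro ⟨n, hn⟩
    exact ⟨n + 1, by rw [Function.iterate_succ_apply, extendMap_inclVertex, hn]⟩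

/-- A quantity preserved by `f` is constant along orbits. -/
theorem ReachesLast.eq_of_invariant {f : Fin (k - 1) → Fin k} {β : Type*} {g : Fin k → β}
    (hg : ∀ i, g (f i) = g (inclVertex i)) {v : Fin k} (hv : ReachesLast f v) :
    g v = g (lastVertex k) := by
  obtain ⟨n, hn⟩ := hv
  have hstep : ∀ w, g (extendMap f w) = g w := by
    intro w
    by_cases hw : w = lastVertex k
    · rw [hw, extendMap_lastVertex]
    · obtain ⟨i, rfl⟩ := exists_inclVertex_of_ne_lastVertex hw
      rw [extendMap_inclVertex, hg]
  rw [← hn]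
  clear hn
  induction n with
  | zero => rfl
  | succ n ih => rw [Function.iterate_succ_apply', hstep, ← ih]

/-- The rank is the number of steps needed to reach `k`. It certifies acyclicity, both for the tree
property and for the Laplacian determinant. -/
theorem exists_rank_of_reachesLast {f : Fin (k - 1) → Fin k} (hf : ∀ v, ReachesLast f v) :
    ∃ d : Fin k → ℕ, ∀ i, d (f i) < d (inclVertex i) := by
  classical
  refine ⟨fun v => Nat.find (hf v), fun i => ?_⟩
  have h := Nat.find_spec (hf (inclVertex i))
  obtain ⟨n, hn⟩ : ∃ n, Nat.find (hf (inclVertex i)) = n + 1 := by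
    refine Nat.exists_eq_succ_of_ne_zero fun h0 => ?_
    rw [h0] at h
    exact inclVertex_ne_lastVertex i h
  rw [hn, Function.iterate_succ_apply, extendMap_inclVertex] at h
  change Nat.find (hf (f i)) < Nat.find (hf (inclVertex i))
  rw [hn]
  exact Nat.lt_succ_of_le (Nat.find_min' _ h)

/-- Reaching `k` passes along an arc in both directions, since out-arcs are unique; so connectedness
suffices for one implication. Conversely, the rank excludes loops and opposite arcs, and a connected
graph on `k` vertices with at most `k - 1` edges is a tree. -/
theorem isDirectedTree_arcDigraph_iff {r : ℕ} (ζ : Fin k → Finset (Fin k) → Fin k)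
    (S : Fin r → Finset (Fin k)) (φ : Fin (k - 1) → Fin r) :
    IsDirectedTree (arcDigraph ζ S φ) ↔
      ∀ v, ReachesLast (fun i => ζ (inclVertex i) (S (φ i))) v := by
  set f : Fin (k - 1) → Fin k := fun i => ζ (inclVertex i) (S (φ i)) with hf
  have hadj : ∀ u v, (arcDigraph ζ S φ).Adj u v ↔ ∃ i, u = inclVertex i ∧ v = f i :=
    fun u v => Iff.rfl
  constructor
  · rintro ⟨-, -, htree⟩ v
    obtain ⟨w⟩ := htree.connected.preconnected v (lastVertex k)
    suffices ∀ u v, (arcDigraph ζ S φ).toSimpleGraphInclusive.Walk u v →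
        ReachesLast f v → ReachesLast f u from this _ _ w (reachesLast_lastVertex f)
    intro u v w hv
    induction w with
    | nil => exact hv
    | cons h p ih =>
      specialize ih hv
      rcases (SimpleGraph.fromRel_adj _ _ _).1 h with ⟨-, h | h⟩
      · obtain ⟨i, rfl, rfl⟩ := (hadj _ _).1 h
        exact (reachesLast_inclVertex_iff f i).2 ih
      · obtain ⟨i, rfl, rfl⟩ := (hadj _ _).1 h
        exact (reachesLast_inclVertex_iff f i).1 ih
  · intro h
    obtain ⟨d, hd⟩ := exists_rank_of_reachesLast h
    have hlt : ∀ u v, (arcDigraph ζ S φ).Adj u v → d v < d u := by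
      rintro u v ⟨i, rfl, rfl⟩
      exact hd i
    refine ⟨fun v hv => (hlt v v hv).false, fun u v huv hvu =>
      ((hlt u v huv).trans (hlt v u hvu)).false, ?_⟩
    have hadj' : ∀ i, (arcDigraph ζ S φ).toSimpleGraphInclusive.Adj (inclVertex i) (f i) := by
      intro i
      refine (SimpleGraph.fromRel_adj _ _ _).2 ⟨fun e => ?_, Or.inl ⟨i, rfl, rfl⟩⟩
      have := hd i
      rw [← e] at this
      exact this.false
    have hreach : ∀ v, (arcDigraph ζ S φ).toSimpleGraphInclusive.Reachable v (lastVertex k) := by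
      intro v
      obtain ⟨n, hn⟩ := h v
      induction n generalizing v with
      | zero => rw [show v = lastVertex k from hn]
      | succ n ih =>
        by_cases hv : v = lastVertex k
        · rw [hv]
        · obtain ⟨i, rfl⟩ := exists_inclVertex_of_ne_lastVertex hv
          rw [Function.iterate_succ_apply, extendMap_inclVertex] at hn
          exact (hadj' i).reachable.trans (ih _ hn)
    have hconn : (arcDigraph ζ S φ).toSimpleGraphInclusive.Connected :=
      { preconnected := fun u v => (hreach u).trans (hreach v).symm
        nonempty := ⟨lastVertex k⟩ }
    rw [SimpleGraph.isTree_iff_connected_and_card]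
    refine ⟨hconn, le_antisymm ?_ hconn.card_vert_le_card_edgeSet_add_one⟩
    have hsub : (arcDigraph ζ S φ).toSimpleGraphInclusive.edgeSet ⊆
        Set.range fun i => s(inclVertex i, f i) := by
      intro e
      induction e with
      | _ u v =>
        intro he
        rcases (SimpleGraph.fromRel_adj _ _ _).1 he with ⟨-, ⟨i, rfl, rfl⟩ | ⟨i, rfl, rfl⟩⟩
        · exact ⟨i, rfl⟩
        · exact ⟨i, Sym2.eq_swap⟩
    have h1 := Nat.card_mono (Set.finite_range _) hsub
    have h2 : Nat.card (Set.range fun i => s(inclVertex i, f i)) ≤ k - 1 := by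
      have := Finite.card_range_le (fun i => s(inclVertex i, f i))
      simpa using this
    have := NeZero.pos k
    simp only [Nat.card_eq_fintype_card (α := Fin k), Fintype.card_fin]
    omega

end Functional

/-! ### Reduced Laplacians and the matrix-tree theorem -/

/-- A matrix with unit diagonal whose off-diagonal entries strictly decrease some rank has
determinant one. -/
theorem Matrix.det_eq_one_of_rank {n R : Type*} [Fintype n] [DecidableEq n] [CommRing R]
    (A : Matrix n n R) (d : n → ℕ) (hdiag : ∀ i, A i i = 1)
    (hd : ∀ i j, i ≠ j → A i j ≠ 0 → d j < d i) : A.det = 1 := by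
  rw [Matrix.det_apply, Finset.sum_eq_single 1]
  · simp [hdiag]
  · intro σ _ hσ
    by_contra hne
    have hentry : ∀ i, A (σ i) i ≠ 0 := by
      intro i hi
      apply hne
      rw [Finset.prod_eq_zero (f := fun i => A (σ i) i) (Finset.mem_univ i) hi, smul_zero]
    have hle : ∀ i ∈ Finset.univ, d i ≤ d (σ i) := by
      intro i _
      by_cases h : σ i = i
      · rw [h]
      · exact (hd _ _ h (hentry i)).le
    obtain ⟨i, hi⟩ : ∃ i, σ i ≠ i := by
      by_contra! h
      exact hσ (Equiv.ext h)
    -- A non-identity permutation with nonzero product would strictly increase the total rank, which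
    -- permutations preserve.
    have hlt := Finset.sum_lt_sum hle ⟨i, Finset.mem_univ i, hd _ _ hi (hentry i)⟩
    rw [Equiv.sum_comp σ d] at hlt
    exact hlt.false
  · simp

section Laplacian

variable {k : ℕ}

/-- The basis vector of a vertex, restricted to the coordinates in `[k - 1]`. -/
def vertexVec (v : Fin k) : Fin (k - 1) → ℝ := fun j => if inclVertex j = v then 1 else 0

theorem vertexVec_inclVertex (i j : Fin (k - 1)) :
    vertexVec (inclVertex i) j = if i = j then 1 else 0 := by
  simp [vertexVec, inclVertex_injective.eq_iff, eq_comm]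

variable [NeZero k]

open Classical in
/-- The matrix-tree theorem for a functional digraph rooted at the last vertex. -/
theorem det_laplacian (f : Fin (k - 1) → Fin k) :
    (Matrix.of fun i => vertexVec (inclVertex i) - vertexVec (f i)).det =
      if ∀ v, ReachesLast f v then 1 else 0 := by
  split_ifs with h
  · obtain ⟨d, hd⟩ := exists_rank_of_reachesLast h
    refine Matrix.det_eq_one_of_rank _ (fun i => d (inclVertex i)) (fun i => ?_) fun i j hij h0 => ?_
    · have : inclVertex i ≠ f i := fun e => by
        have := hd i
        rw [← e] at this
        exact this.false
      simp [vertexVec, this]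
    · have : inclVertex j = f i := by
        by_contra hne
        apply h0
        simp [vertexVec_inclVertex, hij]
        simp [vertexVec, hne]
      rw [this]
      exact hd i
  · push Not at h
    obtain ⟨v, hv⟩ := h
    rw [← Matrix.exists_mulVec_eq_zero_iff]
    -- Kernel vector: `g` is constant along arcs and vanishes at `k`, so deleting the coordinate `k`
    -- loses nothing.
    let g : Fin k → ℝ := fun v => if ReachesLast f v then 0 else 1
    have hsum : ∀ v, ∑ j, vertexVec v j * g (inclVertex j) = g v := by
      intro v
      by_cases hv : v = lastVertex k
      · subst hv
        simp [vertexVec, inclVertex_ne_lastVertex, g, reachesLast_lastVertex]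
      · obtain ⟨i, rfl⟩ := exists_inclVertex_of_ne_lastVertex hv
        simp [vertexVec_inclVertex]
    obtain ⟨i, rfl⟩ : ∃ i : Fin (k - 1), inclVertex i = v :=
      exists_inclVertex_of_ne_lastVertex fun e => hv (e ▸ reachesLast_lastVertex f)
    refine ⟨fun j => g (inclVertex j), fun h0 => ?_, funext fun i => ?_⟩
    · have := congrFun h0 i
      simp [g, hv] at this
    · simp only [Matrix.mulVec, dotProduct, Matrix.of_apply, Pi.sub_apply, sub_mul,
        Finset.sum_sub_distrib, hsum, Pi.zero_apply]
      simp [g, reachesLast_inclVertex_iff]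

end Laplacian

/-! ### Recursions for `α`, `β`, `γ` along the cycle -/

section CyclicMaps

variable {k : ℕ} [NeZero k]

theorem Fin.val_sub_one_of_ne {x : Fin k} (hx : x ≠ 0) : (x - 1).val = x.val - 1 := by
  obtain ⟨m, rfl⟩ : ∃ m, k = m + 1 := ⟨k - 1, by have := NeZero.pos k; omega⟩
  exact Fin.val_sub_one_of_ne_zero hx

theorem alphaMap_spec (i : Fin k) {S : Finset (Fin k)} (hS : S ≠ Finset.univ) :
    alphaMap i S ∉ S ∧ cycIoc i (alphaMap i S - 1) ⊆ S := by
  rw [alphaMap, dif_neg hS]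
  exact Fintype.choose_spec _ (existsUnique_alpha i S hS)

theorem alphaMap_eq_of {i j : Fin k} {S : Finset (Fin k)} (hS : S ≠ Finset.univ) (hj : j ∉ S)
    (h : cycIoc i (j - 1) ⊆ S) : alphaMap i S = j :=
  (existsUnique_alpha i S hS).unique (alphaMap_spec i hS) ⟨hj, h⟩

theorem betaMap_spec (i : Fin k) {S : Finset (Fin k)} (hS : S ≠ Finset.univ) :
    betaMap i S + 1 ∉ S ∧ cycIoc i (betaMap i S) ⊆ S := by
  rw [betaMap, dif_neg hS]
  exact Fintype.choose_spec _ (existsUnique_beta i S hS)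

theorem betaMap_eq (i : Fin k) {S : Finset (Fin k)} (hS : S ≠ Finset.univ) :
    betaMap i S = alphaMap i S - 1 := by
  have h := betaMap_spec i hS
  rw [alphaMap_eq_of hS h.1 (by simpa using h.2)]
  simp

theorem gammaMap_of_mem {i : Fin k} {S : Finset (Fin k)} (hS : S ≠ Finset.univ) (hi : i ∈ S) :
    gammaMap i S = i - 1 := by
  rw [gammaMap, dif_neg hS, if_pos hi]

theorem gammaMap_of_notMem {i : Fin k} {S : Finset (Fin k)} (hS : S ≠ Finset.univ) (hi : i ∉ S) :
    gammaMap i S = alphaMap i S - 1 := by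
  rw [← betaMap_eq i hS, gammaMap, dif_neg hS, if_neg hi, betaMap, dif_neg hS]

theorem alphaMap_of_notMem {i : Fin k} {S : Finset (Fin k)} (hS : S ≠ Finset.univ)
    (hi : i + 1 ∉ S) : alphaMap i S = i + 1 := by
  refine alphaMap_eq_of hS hi fun x hx => ?_
  simp only [cycIoc, Finset.mem_filter, add_sub_cancel_right, sub_self, Fin.val_zero] at hx
  omega

theorem alphaMap_of_mem {i : Fin k} {S : Finset (Fin k)} (hS : S ≠ Finset.univ)
    (hi : i + 1 ∈ S) : alphaMap i S = alphaMap (i + 1) S := by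
  obtain ⟨h1, h2⟩ := alphaMap_spec (i + 1) hS
  refine alphaMap_eq_of hS h1 fun x hx => ?_
  by_cases hx1 : x = i + 1
  · rwa [hx1]
  apply h2
  simp only [cycIoc, Finset.mem_filter, Finset.mem_univ, true_and] at hx ⊢
  have e1 : ∀ y : Fin k, y - (i + 1) = (y - i) - 1 := fun y => by abel
  have hx0 : x - i ≠ 0 := fun h => by simp [h] at hx
  have hj0 : alphaMap (i + 1) S - 1 - i ≠ 0 := fun h => by
    rw [h] at hx
    simp only [Fin.val_zero] at hx
    omega
  have hx2 : (x - i - 1).val ≠ 0 := fun h => hx1 <| by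
    have : x - i - 1 = 0 := Fin.ext (by simpa using h)
    rw [← sub_eq_zero, e1, this]
  rw [e1, e1 (alphaMap (i + 1) S - 1), Fin.val_sub_one_of_ne hx0, Fin.val_sub_one_of_ne hj0]
  rw [Fin.val_sub_one_of_ne hx0] at hx2
  omega

theorem alphaMap_sub_one_of_notMem {i : Fin k} {S : Finset (Fin k)} (hS : S ≠ Finset.univ)
    (hi : i ∉ S) : alphaMap (i - 1) S = i := by
  rw [alphaMap_of_notMem hS (by simpa using hi), sub_add_cancel]

theorem alphaMap_sub_one_of_mem {i : Fin k} {S : Finset (Fin k)} (hS : S ≠ Finset.univ)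
    (hi : i ∈ S) : alphaMap (i - 1) S = alphaMap i S := by
  rw [alphaMap_of_mem hS (by simpa using hi), sub_add_cancel]

/-- Moves by `γ` keep the next missing element unchanged; this invariant detects when `γ` gives a
tree. -/
theorem alphaMap_gammaMap {S : Finset (Fin k)} (hS : S ≠ Finset.univ) (i : Fin k) :
    alphaMap (gammaMap i S) S = alphaMap i S := by
  by_cases hi : i ∈ S
  · rw [gammaMap_of_mem hS hi, alphaMap_sub_one_of_mem hS hi]
  · rw [gammaMap_of_notMem hS hi, alphaMap_sub_one_of_notMem hS (alphaMap_spec i hS).1]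

end CyclicMaps

/-! ### Interpolation of multi-affine functions -/

section Interpolation

/-- A function that is affine in each of its variables is determined by its values at the vertices
of the cube. -/
theorem eq_sum_of_affine_update {ι : Type*} [Fintype ι] [DecidableEq ι] (Φ : (ι → ℝ) → ℝ)
    (h : ∀ a m x, Φ (Function.update a m x) =
      (1 - x) * Φ (Function.update a m 0) + x * Φ (Function.update a m 1)) (a : ι → ℝ) :
    Φ a = ∑ S : Finset ι, (∏ i, if i ∈ S then a i else 1 - a i) *
      Φ (fun i => if i ∈ S then 1 else 0) := by
  -- Only the variables in `s` are expanded; the others keep their values `a i`, which lets the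
  -- induction add one variable at a time.
  have key : ∀ s : Finset ι, Φ a = ∑ S ∈ s.powerset, (∏ i ∈ s, if i ∈ S then a i else 1 - a i) *
      Φ (fun i => if i ∈ s then (if i ∈ S then 1 else 0) else a i) := by
    intro s
    induction s using Finset.induction_on with
    | empty => simp
    | insert m s hm ih =>
      rw [ih, Finset.sum_powerset_insert hm, ← Finset.sum_add_distrib]
      refine Finset.sum_congr rfl fun S hS => ?_
      have hmS : m ∉ S := fun h' => hm (Finset.mem_powerset.1 hS h')
      have hp1 : ∏ i ∈ insert m s, (if i ∈ S then a i else 1 - a i) =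
          (1 - a m) * ∏ i ∈ s, if i ∈ S then a i else 1 - a i := by
        rw [Finset.prod_insert hm, if_neg hmS]
      have hp2 : ∏ i ∈ insert m s, (if i ∈ insert m S then a i else 1 - a i) =
          a m * ∏ i ∈ s, if i ∈ S then a i else 1 - a i := by
        rw [Finset.prod_insert hm, if_pos (Finset.mem_insert_self _ _)]
        congr 1
        refine Finset.prod_congr rfl fun i hi => ?_
        have : i ≠ m := fun e => hm (e ▸ hi)
        simp [this]
      rw [hp1, hp2]
      have h0 := h (fun i => if i ∈ s then (if i ∈ S then 1 else 0) else a i) m (a m)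
      have e0 : Function.update (fun i => if i ∈ s then (if i ∈ S then (1 : ℝ) else 0) else a i) m
          (a m) = fun i => if i ∈ s then (if i ∈ S then 1 else 0) else a i := by
        ext i
        by_cases hi : i = m
        · subst hi; simp [hm]
        · simp [hi]
      have e1 : Function.update (fun i => if i ∈ s then (if i ∈ S then (1 : ℝ) else 0) else a i) m
          0 = fun i => if i ∈ insert m s then (if i ∈ S then 1 else 0) else a i := by
        ext i
        by_cases hi : i = m
        · subst hi; simp [hmS]
        · simp [hi]
      have e2 : Function.update (fun i => if i ∈ s then (if i ∈ S then (1 : ℝ) else 0) else a i) m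
          1 = fun i => if i ∈ insert m s then (if i ∈ insert m S then 1 else 0) else a i := by
        ext i
        by_cases hi : i = m
        · subst hi; simp
        · simp [hi]
      rw [e0, e1, e2] at h0
      rw [h0]
      ring
  have := key Finset.univ
  simpa using this

/-- Families of subsets are subsets of the product. -/
def familyEquiv (ρ κ : Type*) [Fintype ρ] [Fintype κ] [DecidableEq ρ] [DecidableEq κ] :
    (ρ → Finset κ) ≃ Finset (ρ × κ) where
  toFun S := Finset.univ.filter fun x => x.2 ∈ S x.1
  invFun T t := Finset.univ.filter fun i => (t, i) ∈ T
  left_inv S := by ext; simp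
  right_inv T := by ext; simp

end Interpolation

/-! ### The linked cyclic systems and their determinant -/

section Link

variable {k : ℕ} [NeZero k] {ρ n : Type*} [Fintype ρ] [DecidableEq ρ] [Fintype n] [DecidableEq n]

/-- The matrix of the system `t x - a x * t (x + 1)`, on copies of the cycle `[k]`. -/
def cycleMatrix (a : ρ × Fin k → ℝ) : Matrix (ρ × Fin k) (ρ × Fin k) ℝ :=
  Matrix.of fun x y => (if x = y then 1 else 0) - (if y = (x.1, x.2 + 1) then a x else 0)

/-- The matrix whose Schur complement has the rows `b i + ∑ l, M i l • t (φ i, l)`, where `t` is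
the solution of `t x = a x • (c x.2 + t (x + 1))`. -/
def linkMatrix (c : Fin k → n → ℝ) (M : n → Fin k → ℝ) (b : n → n → ℝ) (φ : n → ρ)
    (a : ρ × Fin k → ℝ) : Matrix ((ρ × Fin k) ⊕ n) ((ρ × Fin k) ⊕ n) ℝ :=
  Matrix.fromBlocks (cycleMatrix a) (Matrix.of fun x j => -(a x * c x.2 j))
    (Matrix.of fun i y => if φ i = y.1 then M i y.2 else 0) (Matrix.of b)

theorem cycleMatrix_mul {a : ρ × Fin k → ℝ} {m : Type*} (t : Matrix (ρ × Fin k) m ℝ) (x j) :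
    (cycleMatrix a * t) x j = t x j - a x * t (x.1, x.2 + 1) j := by
  simp [cycleMatrix, Matrix.mul_apply, sub_mul, Finset.sum_sub_distrib]

/-- Schur complement by a column operation: multiplying by a unipotent matrix built from `t` clears
the upper right block. A solution `t` is enough; invertibility of the cycle block is not needed. -/
theorem det_linkMatrix_of_solution (c : Fin k → n → ℝ) (M : n → Fin k → ℝ) (b : n → n → ℝ)
    (φ : n → ρ) {a : ρ × Fin k → ℝ} {t : ρ × Fin k → n → ℝ}
    (ht : ∀ x j, t x j = a x * (c x.2 j + t (x.1, x.2 + 1) j)) :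
    (linkMatrix c M b φ a).det = (cycleMatrix a).det *
      (Matrix.of fun i j => b i j + ∑ l, M i l * t (φ i, l) j).det := by
  have h1 : linkMatrix c M b φ a * Matrix.fromBlocks 1 (Matrix.of t) 0 1 =
      Matrix.fromBlocks (cycleMatrix a) 0
        (Matrix.of fun i y => if φ i = y.1 then M i y.2 else 0)
        (Matrix.of fun i j => b i j + ∑ l, M i l * t (φ i, l) j) := by
    rw [linkMatrix, Matrix.fromBlocks_multiply]
    congr 1
    · simp
    · ext x j
      simp only [Matrix.mul_one, Matrix.add_apply, cycleMatrix_mul, Matrix.of_apply,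
        Matrix.zero_apply]
      rw [ht x j]
      ring
    · simp
    · ext i j
      simp only [Matrix.mul_one, Matrix.add_apply, Matrix.mul_apply, Matrix.of_apply,
        Fintype.sum_prod_type, ite_mul, zero_mul]
      rw [Finset.sum_eq_single (φ i)]
      · simp [add_comm]
      · intro t' _ ht'
        simp [ht'.symm]
      · simp
  have h2 := congrArg Matrix.det h1
  rwa [Matrix.det_mul, Matrix.det_fromBlocks_zero₂₁, Matrix.det_fromBlocks_zero₁₂, Matrix.det_one,
    Matrix.det_one, mul_one, mul_one] at h2

/-- The parameter `a m` occurs only in the row of `m`, where it enters affinely. -/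
theorem det_linkMatrix_update (c : Fin k → n → ℝ) (M : n → Fin k → ℝ) (b : n → n → ℝ)
    (φ : n → ρ) (a : ρ × Fin k → ℝ) (m : ρ × Fin k) (x : ℝ) :
    (linkMatrix c M b φ (Function.update a m x)).det =
      (1 - x) * (linkMatrix c M b φ (Function.update a m 0)).det +
        x * (linkMatrix c M b φ (Function.update a m 1)).det := by
  have hrow : ∀ y : ℝ, linkMatrix c M b φ (Function.update a m y) =
      (linkMatrix c M b φ a).updateRow (Sum.inl m)
        (linkMatrix c M b φ (Function.update a m y) (Sum.inl m)) := by
    intro y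
    ext u v
    by_cases hu : u = Sum.inl m
    · subst hu; simp
    · rw [Matrix.updateRow_ne hu]
      rcases u with u | u
      · have hum : u ≠ m := fun e => hu (by rw [e])
        rcases v with v | v <;> simp [linkMatrix, cycleMatrix, hum]
      · rcases v with v | v <;> simp [linkMatrix]
  have hlin : linkMatrix c M b φ (Function.update a m x) (Sum.inl m) =
      (1 - x) • linkMatrix c M b φ (Function.update a m 0) (Sum.inl m) +
        x • linkMatrix c M b φ (Function.update a m 1) (Sum.inl m) := by
    ext v
    rcases v with v | v
    · simp only [linkMatrix, cycleMatrix, Matrix.fromBlocks_apply₁₁, Matrix.of_apply, Pi.add_apply,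
        Pi.smul_apply, Function.update_self, smul_eq_mul]
      split_ifs <;> ring
    · simp only [linkMatrix, Matrix.fromBlocks_apply₁₂, Matrix.of_apply, Pi.add_apply,
        Pi.smul_apply, Function.update_self, smul_eq_mul]
      ring
  rw [hrow x, hlin, Matrix.det_updateRow_add, Matrix.det_updateRow_smul,
    Matrix.det_updateRow_smul, ← hrow, ← hrow]

/-- The matrix is singular if the parameters are one along a whole cycle. -/
theorem det_linkMatrix_of_full {c : Fin k → n → ℝ} (hc : ∀ j, ∑ i, c i j = 0)
    (M : n → Fin k → ℝ) (b : n → n → ℝ) (φ : n → ρ) {a : ρ × Fin k → ℝ} {t : ρ}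
    (ha : ∀ i, a (t, i) = 1) : (linkMatrix c M b φ a).det = 0 := by
  rw [← Matrix.exists_vecMul_eq_zero_iff]
  -- Adding up the rows of cycle `t` gives zero: the cycle block contributes `1 - 1` in each of its
  -- columns, and the `c` block contributes `-∑ c`.
  refine ⟨Sum.elim (fun x => if x.1 = t then 1 else 0) 0, fun h => ?_, funext fun v => ?_⟩
  · have := congrFun h (Sum.inl (t, 0))
    simp at this
  · have hsum : ∀ g : ρ × Fin k → ℝ, ∑ x : ρ × Fin k, (if x.1 = t then 1 else 0) * g x =
        ∑ i, g (t, i) := by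
      intro g
      rw [Fintype.sum_prod_type, Finset.sum_eq_single t]
      · simp
      · intro t' _ ht'
        simp [ht']
      · simp
    rcases v with v | v
    · simp only [Matrix.vecMul, dotProduct, Fintype.sum_sum_type, Sum.elim_inl, Sum.elim_inr,
        Pi.zero_apply, zero_mul, Finset.sum_const_zero, add_zero]
      rw [hsum]
      obtain ⟨v1, v2⟩ := v
      simp only [linkMatrix, cycleMatrix, Matrix.fromBlocks_apply₁₁, Matrix.of_apply, ha,
        Finset.sum_sub_distrib, Prod.mk.injEq]
      by_cases hv : v1 = t
      · subst hv
        have : ∀ i : Fin k, v2 = i + 1 ↔ v2 - 1 = i := fun i => by rw [sub_eq_iff_eq_add]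
        simp [this]
      · simp [hv, Ne.symm hv]
    · simp only [Matrix.vecMul, dotProduct, Fintype.sum_sum_type, Sum.elim_inl, Sum.elim_inr,
        Pi.zero_apply, zero_mul, Finset.sum_const_zero, add_zero]
      rw [hsum]
      simp [linkMatrix, ha, hc]

/-- An entry from `x` to its successor survives only for elements of the set, so every cycle is cut
at a missing element `m`. The forward distance to `m` is a strictly decreasing rank. -/
theorem det_cycleMatrix_of_proper {S : ρ → Finset (Fin k)} (hS : ∀ t, S t ≠ Finset.univ) :
    (cycleMatrix fun x => if x.2 ∈ S x.1 then (1 : ℝ) else 0).det = 1 := by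
  have hm : ∀ t, ∃ m, m ∉ S t := by
    intro t
    by_contra! h
    exact hS t (Finset.eq_univ_iff_forall.2 h)
  choose m hm using hm
  have hne : ∀ x : ρ × Fin k, x.2 ∈ S x.1 → m x.1 - x.2 ≠ 0 := fun x hx h =>
    hm x.1 (by rwa [sub_eq_zero.1 h])
  refine Matrix.det_eq_one_of_rank _ (fun x => (m x.1 - x.2).val) (fun x => ?_)
    fun x y hxy h0 => ?_
  · have : x.2 ∈ S x.1 → x ≠ (x.1, x.2 + 1) := by
      intro hx h
      have h1 : x.2 = x.2 + 1 := congrArg Prod.snd h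
      have h2 : (1 : Fin k) = 0 := by simpa using h1.symm
      have h3 : ∀ y : Fin k, y = 0 := fun y => by rw [← mul_one y, h2, mul_zero]
      exact hne x hx (h3 _)
    simp only [cycleMatrix, Matrix.of_apply, if_true]
    split_ifs with h1 h2
    · exact absurd h1 (this h2)
    · simp
    · simp
  · simp only [cycleMatrix, Matrix.of_apply, hxy, if_false] at h0
    split_ifs at h0 with h1 h2
    · subst h1
      have e : m x.1 - (x.2 + 1) = (m x.1 - x.2) - 1 := by abel
      have h3 := hne x h2
      have h4 : (m x.1 - x.2).val ≠ 0 := fun h => h3 (Fin.ext (by simpa using h))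
      simp only [e, Fin.val_sub_one_of_ne h3]
      omega
    · simp at h0
    · simp at h0

/-- The cycle matrix is strictly diagonally dominant: as `1 < k`, the diagonal is 1 and each row has
just one other entry, `-a`. -/
theorem exists_cycle_solution {m : Type*} (hk : 1 < k) (c : Fin k → m → ℝ) {a : Fin k → ℝ}
    (ha : ∀ i, |a i| < 1) : ∃ t : Fin k → m → ℝ, ∀ i j, t i j = a i * (c i j + t (i + 1) j) := by
  have hdet : (cycleMatrix fun x : Unit × Fin k => a x.2).det ≠ 0 := by
    refine det_ne_zero_of_sum_row_lt_diag fun x => ?_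
    have hx : x ≠ (x.1, x.2 + 1) := by
      intro h
      have h1 : x.2 = x.2 + 1 := congrArg Prod.snd h
      have h2 : (1 : Fin k) = 0 := by simpa using h1.symm
      have h3 := congrArg Fin.val h2
      rw [Fin.val_one', Nat.mod_eq_of_lt hk] at h3
      simp at h3
    have hsum : ∑ y ∈ Finset.univ.erase x, ‖cycleMatrix (fun x : Unit × Fin k => a x.2) x y‖ ≤
        |a x.2| := by
      calc _ ≤ ∑ y ∈ Finset.univ.erase x, if y = (x.1, x.2 + 1) then |a x.2| else 0 := by
            refine Finset.sum_le_sum fun y hy => ?_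
            have hy : x ≠ y := (Finset.ne_of_mem_erase hy).symm
            simp only [cycleMatrix, Matrix.of_apply, hy, if_false]
            split_ifs <;> simp
        _ ≤ ∑ y, if y = (x.1, x.2 + 1) then |a x.2| else 0 :=
            Finset.sum_le_sum_of_subset_of_nonneg (Finset.erase_subset _ _) fun y _ _ => by
              split_ifs <;> positivity
        _ = |a x.2| := by simp
    refine hsum.trans_lt ?_
    have : cycleMatrix (fun x : Unit × Fin k => a x.2) x x = 1 := by
      simp only [cycleMatrix, Matrix.of_apply, if_true, if_neg hx, sub_zero]
    rw [this, norm_one]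
    exact ha _
  obtain ⟨t, ht⟩ : ∃ t : Matrix (Unit × Fin k) m ℝ,
      cycleMatrix (fun x : Unit × Fin k => a x.2) * t =
        Matrix.of fun x j => a x.2 * c x.2 j :=
    ⟨_, Matrix.mul_nonsing_inv_cancel_left _ _ (isUnit_iff_ne_zero.2 hdet)⟩
  refine ⟨fun i => t ((), i), fun i j => ?_⟩
  have := congrFun (congrFun ht ((), i)) j
  rw [cycleMatrix_mul] at this
  simp only [Matrix.of_apply] at this
  linear_combination this

/-- The weighted sum of the determinants over all tuples of proper sets does not depend on which
set governs which row. -/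
theorem sum_weight_mul_det_eq (hk : 1 < k) {c : Fin k → n → ℝ} (hc : ∀ j, ∑ i, c i j = 0)
    (M : n → Fin k → ℝ) (b : n → n → ℝ) {T : Finset (Fin k) → Fin k → n → ℝ}
    (hT : ∀ S, S ≠ Finset.univ → ∀ i j, T S i j = if i ∈ S then c i j + T S (i + 1) j else 0)
    {a : Fin k → ℝ} (ha : ∀ i, |a i| < 1) (φ φ' : n → ρ) :
    ∑ S : ρ → Finset (Fin k), (∏ x : ρ × Fin k, if x.2 ∈ S x.1 then a x.2 else 1 - a x.2) *
        (if ∀ t, S t ≠ Finset.univ then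
          (Matrix.of fun i j => b i j + ∑ l, M i l * T (S (φ i)) l j).det else 0) =
      ∑ S : ρ → Finset (Fin k), (∏ x : ρ × Fin k, if x.2 ∈ S x.1 then a x.2 else 1 - a x.2) *
        (if ∀ t, S t ≠ Finset.univ then
          (Matrix.of fun i j => b i j + ∑ l, M i l * T (S (φ' i)) l j).det else 0) := by
  obtain ⟨t, ht⟩ := exists_cycle_solution hk c ha
  have key : ∀ φ : n → ρ, ∑ S : ρ → Finset (Fin k),
      (∏ x : ρ × Fin k, if x.2 ∈ S x.1 then a x.2 else 1 - a x.2) *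
        (if ∀ t, S t ≠ Finset.univ then
          (Matrix.of fun i j => b i j + ∑ l, M i l * T (S (φ i)) l j).det else 0) =
      (cycleMatrix fun x : ρ × Fin k => a x.2).det *
        (Matrix.of fun i j => b i j + ∑ l, M i l * t l j).det := by
    intro φ
    -- The same solution is used in every copy, so the Schur complement on the right has lost its
    -- dependence on `φ`.
    rw [← det_linkMatrix_of_solution (t := fun x => t x.2) c M b φ fun x j => ht x.2 j,
      eq_sum_of_affine_update (fun a => (linkMatrix c M b φ a).det)
        (det_linkMatrix_update c M b φ)]
    refine Fintype.sum_equiv (familyEquiv ρ (Fin k)) _ _ fun S => ?_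
    congr 1
    · simp [familyEquiv]
    · have e : (fun x => if x ∈ familyEquiv ρ (Fin k) S then (1 : ℝ) else 0) =
          fun x => if x.2 ∈ S x.1 then 1 else 0 := by
        simp [familyEquiv]
      rw [e]
      split_ifs with hS
      · rw [det_linkMatrix_of_solution (t := fun x => T (S x.1) x.2),
          det_cycleMatrix_of_proper hS, one_mul]
        intro x j
        rw [hT _ (hS _)]
        split_ifs <;> simp
      · push Not at hS
        obtain ⟨t, ht⟩ := hS
        rw [det_linkMatrix_of_full hc M b φ (t := t)]
        simp [ht]
  rw [key, key]

end Link

/-! ### Extracting fixed multiplicities -/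

section Extraction

variable {k r : ℕ}

theorem mem_tuplesS_iff {p : Fin k → ℤ} {S : Fin r → Finset (Fin k)} :
    S ∈ tuplesS p r ↔ ∀ j, ((Finset.univ.filter fun t => j ∈ S t).card : ℤ) = p j := by
  simp [tuplesS]

/-- If a weighted sum over all tuples of sets vanishes for all Bernoulli weights, it vanishes on
the tuples with given multiplicities. -/
theorem sum_tuplesS_eq_zero {D : (Fin r → Finset (Fin k)) → ℝ}
    (hD : ∀ a : Fin k → ℝ, (∀ i, |a i| < 1) → ∑ S : Fin r → Finset (Fin k),
      (∏ x : Fin r × Fin k, if x.2 ∈ S x.1 then a x.2 else 1 - a x.2) * D S = 0)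
    (p : Fin k → ℕ) : ∑ S ∈ tuplesS (fun j => (p j : ℤ)) r, D S = 0 := by
  classical
  let N : (Fin r → Finset (Fin k)) → (Fin k →₀ ℕ) := fun S =>
    Finsupp.equivFunOnFinite.symm fun j => (Finset.univ.filter fun t => j ∈ S t).card
  let Q : MvPolynomial (Fin k) ℝ := ∑ S, MvPolynomial.monomial (N S) (D S)
  have hQ : Q = 0 := by
    refine MvPolynomial.funext_set (fun _ => Set.Ioi (0 : ℝ)) (fun _ => Set.Ioi_infinite 0)
      fun y hy => ?_
    have hy : ∀ i, 0 < y i := fun i => hy i (Set.mem_univ i)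
    have hy1 : ∀ i, 0 < 1 + y i := fun i => by have := hy i; positivity
    -- With `a = y / (1 + y)`, each weight becomes the monomial `y ^ N S` over a denominator common
    -- to all tuples, and positive `y` give `|a| < 1`.
    have h := hD (fun i => y i / (1 + y i)) fun i => by
      rw [abs_of_pos (div_pos (hy i) (hy1 i)), div_lt_one (hy1 i)]
      linarith
    have hw : ∀ S : Fin r → Finset (Fin k), (∏ x : Fin r × Fin k,
        if x.2 ∈ S x.1 then y x.2 / (1 + y x.2) else 1 - y x.2 / (1 + y x.2)) =
        (∏ j, y j ^ (N S j)) / ∏ x : Fin r × Fin k, (1 + y x.2) := by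
      intro S
      have h1 : ∀ x : Fin r × Fin k,
          (if x.2 ∈ S x.1 then y x.2 / (1 + y x.2) else 1 - y x.2 / (1 + y x.2)) =
          (if x.2 ∈ S x.1 then y x.2 else 1) / (1 + y x.2) := by
        intro x
        have := (hy1 x.2).ne'
        split_ifs
        · rfl
        · field_simp
          ring
      simp only [h1, Finset.prod_div_distrib]
      congr 1
      rw [Fintype.prod_prod_type_right]
      refine Finset.prod_congr rfl fun j _ => ?_
      simp [Finset.prod_ite, N]
    simp only [hw, div_mul_eq_mul_div, ← Finset.sum_div] at h
    rw [div_eq_zero_iff, or_iff_left (Finset.prod_pos fun x _ => hy1 x.2).ne'] at h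
    simp only [Q, map_sum, MvPolynomial.eval_monomial, map_zero]
    rw [← h]
    refine Finset.sum_congr rfl fun S _ => ?_
    rw [Finsupp.prod_fintype _ _ (by simp), mul_comm]
  have hcoeff := congrArg (MvPolynomial.coeff (Finsupp.equivFunOnFinite.symm p)) hQ
  simp only [Q, MvPolynomial.coeff_sum, MvPolynomial.coeff_monomial, MvPolynomial.coeff_zero]
    at hcoeff
  rw [← hcoeff, tuplesS, Finset.sum_filter]
  refine Finset.sum_congr rfl fun S _ => ?_
  congr 1
  simp only [N, Nat.cast_inj, Equiv.apply_eq_iff_eq, funext_iff]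

end Extraction

/-! ### Independence of the assignment `φ` -/

section Independence

variable {k r : ℕ} [NeZero k]

/-- The vectors `e_i - e_{ζ(i, S)}` are affine in the solution `T S` of a cyclic linear system
whose coefficients are the membership indicators of `S`. -/
def IsCyclicallyLinear (ζ : Fin k → Finset (Fin k) → Fin k) : Prop :=
  ∃ (c : Fin k → Fin (k - 1) → ℝ) (M : Fin (k - 1) → Fin k → ℝ)
    (b : Fin (k - 1) → Fin (k - 1) → ℝ) (T : Finset (Fin k) → Fin k → Fin (k - 1) → ℝ),
    (∀ j, ∑ i, c i j = 0) ∧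
    (∀ S, S ≠ Finset.univ → ∀ i j, T S i j = if i ∈ S then c i j + T S (i + 1) j else 0) ∧
    ∀ S, S ≠ Finset.univ → ∀ i j, vertexVec (inclVertex i) j - vertexVec (ζ (inclVertex i) S) j =
      b i j + ∑ l, M i l * T S l j

open Classical in
/-- The number of tuples for which the digraph is a tree does not depend on the assignment of sets
to vertices. -/
theorem card_isDirectedTree_eq (hk : 1 < k) {ζ : Fin k → Finset (Fin k) → Fin k}
    (hζ : IsCyclicallyLinear ζ) (p : Fin k → ℕ) (φ φ' : Fin (k - 1) → Fin r) :
    ((tuplesM (fun j => (p j : ℤ)) r).filter fun S => IsDirectedTree (arcDigraph ζ S φ)).card =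
      ((tuplesM (fun j => (p j : ℤ)) r).filter fun S =>
        IsDirectedTree (arcDigraph ζ S φ')).card := by
  obtain ⟨c, M, b, T, hc, hT, hrow⟩ := hζ
  let F : (Fin (k - 1) → Fin r) → (Fin r → Finset (Fin k)) → ℝ := fun φ S =>
    if ∀ t, S t ≠ Finset.univ then
      (Matrix.of fun i j => b i j + ∑ l, M i l * T (S (φ i)) l j).det else 0
  have hF : ∀ φ S, F φ S = if (∀ t, S t ≠ Finset.univ) ∧ IsDirectedTree (arcDigraph ζ S φ)
      then 1 else 0 := by
    intro φ S
    by_cases hS : ∀ t, S t ≠ Finset.univ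
    · have e : (Matrix.of fun i j => b i j + ∑ l, M i l * T (S (φ i)) l j) =
          Matrix.of fun i => vertexVec (inclVertex i) - vertexVec (ζ (inclVertex i) (S (φ i))) := by
        ext i j
        simp only [Matrix.of_apply, Pi.sub_apply]
        rw [hrow _ (hS _)]
      simp only [F, if_pos hS, e, det_laplacian, isDirectedTree_arcDigraph_iff]
      congr 1
      simp [hS]
    · simp [F, hS]
  have h0 := sum_tuplesS_eq_zero (D := fun S => F φ S - F φ' S) (fun a ha => by
    simp only [mul_sub, Finset.sum_sub_distrib]
    rw [sub_eq_zero]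
    convert sum_weight_mul_det_eq hk hc M b hT ha φ φ') p
  have hcard : ∀ φ, ∑ S ∈ tuplesS (fun j => (p j : ℤ)) r, F φ S =
      ((tuplesM (fun j => (p j : ℤ)) r).filter fun S =>
        IsDirectedTree (arcDigraph ζ S φ)).card := by
    intro φ
    simp only [hF, tuplesM, Finset.filter_filter, Finset.sum_boole]
  rw [Finset.sum_sub_distrib, sub_eq_zero, hcard, hcard] at h0
  exact_mod_cast h0

theorem sum_vertexVec_sub_shift (j : Fin (k - 1)) :
    ∑ i : Fin k, (vertexVec i j - vertexVec (i + 1) j) = 0 := by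
  rw [Finset.sum_sub_distrib, sub_eq_zero]
  exact (Equiv.sum_comp (Equiv.addRight (1 : Fin k)) fun i => vertexVec i j).symm

/-- With `T_i = e_i - e_{α(i-1)}`, the recursion telescopes through `S` and stops at the first
missing element. The row of `i` is `(e_i - e_{i+1}) + T_{i+1}`. -/
theorem isCyclicallyLinear_alphaMap : IsCyclicallyLinear (k := k) alphaMap := by
  refine ⟨fun i => vertexVec i - vertexVec (i + 1),
    fun i l => if l = inclVertex i + 1 then 1 else 0,
    fun i => vertexVec (inclVertex i) - vertexVec (inclVertex i + 1),
    fun S i => vertexVec i - vertexVec (alphaMap (i - 1) S), sum_vertexVec_sub_shift,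
    fun S hS i j => ?_, fun S hS i j => ?_⟩
  · split_ifs with hi
    · simp [alphaMap_sub_one_of_mem hS hi]
    · simp [alphaMap_sub_one_of_notMem hS hi]
  · simp

/-- The solution of the cyclic system for `β` and `γ`. -/
theorem betaMap_system {S : Finset (Fin k)} (hS : S ≠ Finset.univ) (i : Fin k)
    (j : Fin (k - 1)) :
    (vertexVec (i - 1) - vertexVec (betaMap (i - 1) S) : Fin (k - 1) → ℝ) j =
      if i ∈ S then (vertexVec (i - 1) - vertexVec i : Fin (k - 1) → ℝ) j +
        (vertexVec (i + 1 - 1) - vertexVec (betaMap (i + 1 - 1) S) : Fin (k - 1) → ℝ) j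
      else 0 := by
  simp only [betaMap_eq _ hS]
  split_ifs with hi
  · simp [alphaMap_sub_one_of_mem hS hi]
  · simp [alphaMap_sub_one_of_notMem hS hi]

theorem sum_vertexVec_shift_sub (j : Fin (k - 1)) :
    ∑ i : Fin k, (vertexVec (i - 1) - vertexVec i : Fin (k - 1) → ℝ) j = 0 := by
  simp only [Pi.sub_apply]
  rw [Finset.sum_sub_distrib, sub_eq_zero]
  exact Equiv.sum_comp (Equiv.subRight (1 : Fin k)) fun i => vertexVec i j

/-- Here `T_i = e_{i-1} - e_{β(i-1)}`, and the row of `i` is `T_{i+1}`. -/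
theorem isCyclicallyLinear_betaMap : IsCyclicallyLinear (k := k) betaMap := by
  refine ⟨fun i => vertexVec (i - 1) - vertexVec i,
    fun i l => if l = inclVertex i + 1 then 1 else 0, 0,
    fun S i => vertexVec (i - 1) - vertexVec (betaMap (i - 1) S), sum_vertexVec_shift_sub,
    fun S hS i j => betaMap_system hS i j, fun S hS i j => ?_⟩
  simp

/-- With the same `T` as for `β`, the row of `i` is `T_{i+1} - T_i`: for `i ∈ S` this equals `-c_i =
e_i - e_{i-1}`, and for `i ∉ S` the term `T_i` vanishes. -/
theorem isCyclicallyLinear_gammaMap : IsCyclicallyLinear (k := k) gammaMap := by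
  refine ⟨fun i => vertexVec (i - 1) - vertexVec i,
    fun i l => (if l = inclVertex i + 1 then 1 else 0) - (if l = inclVertex i then 1 else 0), 0,
    fun S i => vertexVec (i - 1) - vertexVec (betaMap (i - 1) S), sum_vertexVec_shift_sub,
    fun S hS i j => betaMap_system hS i j, fun S hS i j => ?_⟩
  simp only [sub_mul, Finset.sum_sub_distrib, ite_mul, one_mul, zero_mul, Finset.sum_ite_eq',
    Finset.mem_univ, if_true, betaMap_eq _ hS, Pi.sub_apply, Pi.zero_apply]
  by_cases hi : inclVertex i ∈ S
  · simp [gammaMap_of_mem hS hi, alphaMap_sub_one_of_mem hS hi]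
  · simp [gammaMap_of_notMem hS hi, alphaMap_sub_one_of_notMem hS hi]

end Independence

/-! ### Trees governed by a single set -/

section SingleSet

variable {k : ℕ} [NeZero k]

theorem lastVertex_add_one : lastVertex k + 1 = 0 := by
  obtain ⟨m, rfl⟩ : ∃ m, k = m + 1 := ⟨k - 1, by have := NeZero.pos k; omega⟩
  exact Fin.last_add_one m

theorem zero_sub_one_eq_lastVertex : (0 : Fin k) - 1 = lastVertex k := by
  rw [← lastVertex_add_one, add_sub_cancel_right]

theorem val_add_one_of_ne_lastVertex {v : Fin k} (hv : v ≠ lastVertex k) :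
    (v + 1).val = v.val + 1 := by
  have h : v + 1 ≠ 0 := fun h => hv (by rw [← zero_sub_one_eq_lastVertex, ← h, add_sub_cancel_right])
  have h1 := Fin.val_sub_one_of_ne h
  have h2 : (v + 1).val ≠ 0 := fun h' => h (Fin.ext (by simpa using h'))
  rw [add_sub_cancel_right] at h1
  generalize (v + 1).val = w at *
  omega

theorem reachesLast_of_lt {f : Fin (k - 1) → Fin k}
    (hf : ∀ i, (inclVertex i).val < (f i).val) (v : Fin k) : ReachesLast f v := by
  induction h : k - v.val using Nat.strong_induction_on generalizing v with
  | _ n ih =>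
    by_cases hv : v = lastVertex k
    · rw [hv]
      exact reachesLast_lastVertex f
    · obtain ⟨i, rfl⟩ := exists_inclVertex_of_ne_lastVertex hv
      rw [reachesLast_inclVertex_iff]
      have := hf i
      have := (f i).isLt
      exact ih _ (by omega) _ rfl

theorem reachesLast_of_sub_one {f : Fin (k - 1) → Fin k}
    (hf : ∀ i, f i = inclVertex i - 1) (v : Fin k) : ReachesLast f v := by
  induction h : v.val generalizing v with
  | zero =>
    by_cases hv : v = lastVertex k
    · rw [hv]
      exact reachesLast_lastVertex f
    · obtain ⟨i, rfl⟩ := exists_inclVertex_of_ne_lastVertex hv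
      have h0 : inclVertex i = 0 := Fin.ext (by simpa using h)
      rw [reachesLast_inclVertex_iff, hf, h0, zero_sub_one_eq_lastVertex]
      exact reachesLast_lastVertex f
  | succ n ih =>
    by_cases hv : v = lastVertex k
    · rw [hv]
      exact reachesLast_lastVertex f
    · obtain ⟨i, rfl⟩ := exists_inclVertex_of_ne_lastVertex hv
      rw [reachesLast_inclVertex_iff, hf]
      refine ih _ ?_
      rw [Fin.val_sub_one_of_ne fun h0 => by simp [h0] at h, h, Nat.add_sub_cancel]

theorem ReachesLast.ne {f : Fin (k - 1) → Fin k} {i : Fin (k - 1)}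
    (h : ReachesLast f (inclVertex i)) : f i ≠ inclVertex i := by
  intro hi
  obtain ⟨n, hn⟩ := h
  rw [Function.iterate_fixed (by rw [extendMap_inclVertex, hi])] at hn
  exact inclVertex_ne_lastVertex i hn

theorem val_lt_alphaMap {S : Finset (Fin k)} (hS : S ≠ Finset.univ) (hl : lastVertex k ∉ S)
    {v : Fin k} (hv : v ≠ lastVertex k) : v.val < (alphaMap v S).val := by
  induction h : k - v.val using Nat.strong_induction_on generalizing v with
  | _ n ih =>
    have h1 := val_add_one_of_ne_lastVertex hv
    by_cases hi : v + 1 ∈ S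
    · rw [alphaMap_of_mem hS hi]
      have := ih (k - (v + 1).val) (by omega) (v := v + 1) (fun e => hl (e ▸ hi)) rfl
      omega
    · rw [alphaMap_of_notMem hS hi]
      omega

/-- Values of `α` avoid `S`, so if `k ∈ S` no arc enters `k`. Otherwise the search for a missing
element never wraps past `k`, and all arcs increase. -/
theorem reachesLast_alphaMap_iff (hk : 1 < k) {S : Finset (Fin k)} (hS : S ≠ Finset.univ) :
    (∀ v, ReachesLast (fun i => alphaMap (inclVertex i) S) v) ↔ lastVertex k ∉ S := by
  constructor
  · intro h hl
    have := (h (inclVertex ⟨0, by omega⟩)).eq_of_invariant (g := fun v => v = lastVertex k)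
      fun i => by
        have : alphaMap (inclVertex i) S ≠ lastVertex k := fun e =>
          (alphaMap_spec (inclVertex i) hS).1 (e ▸ hl)
        simp [this, inclVertex_ne_lastVertex]
    simp [inclVertex_ne_lastVertex] at this
  · intro hl
    exact reachesLast_of_lt fun i => val_lt_alphaMap hS hl (inclVertex_ne_lastVertex i)

theorem compl_singleton_ne_univ {n : ℕ} (m : Fin n) : ({m}ᶜ : Finset (Fin n)) ≠ Finset.univ := by
  simp

theorem alphaMap_compl_singleton (i m : Fin k) : alphaMap i {m}ᶜ = m := by
  simpa using (alphaMap_spec i (compl_singleton_ne_univ m)).1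

/-- A missing `x` puts a loop at `x - 1`, unless `x - 1` is the root, that is, `x = 0`. For `S =
{0}ᶜ` all arcs point to the root. -/
theorem reachesLast_betaMap_iff {S : Finset (Fin k)} (hS : S ≠ Finset.univ) :
    (∀ v, ReachesLast (fun i => betaMap (inclVertex i) S) v) ↔ S = {0}ᶜ := by
  constructor
  · intro h
    have hmem : ∀ x, x ≠ 0 → x ∈ S := by
      intro x hx
      obtain ⟨i, hi⟩ : ∃ i : Fin (k - 1), inclVertex i = x - 1 := by
        refine exists_inclVertex_of_ne_lastVertex fun e => hx ?_
        rw [← lastVertex_add_one, ← e, sub_add_cancel]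
      by_contra hxS
      refine (h (inclVertex i)).ne ?_
      simp only [betaMap_eq _ hS, hi, alphaMap_sub_one_of_notMem hS hxS]
    have h0 : (0 : Fin k) ∉ S := fun h0 => hS <| Finset.eq_univ_iff_forall.2 fun x => by
      by_cases hx : x = 0
      · rwa [hx]
      · exact hmem x hx
    ext x
    rw [Finset.mem_compl, Finset.mem_singleton]
    exact ⟨fun hx e => h0 (e ▸ hx), hmem x⟩
  · rintro rfl v
    by_cases hv : v = lastVertex k
    · rw [hv]
      exact reachesLast_lastVertex _
    · obtain ⟨i, rfl⟩ := exists_inclVertex_of_ne_lastVertex hv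
      rw [reachesLast_inclVertex_iff, betaMap_eq _ hS, alphaMap_compl_singleton,
        zero_sub_one_eq_lastVertex]
      exact reachesLast_lastVertex _

theorem card_eq_pred_iff {S : Finset (Fin k)} : S.card = k - 1 ↔ ∃ m, S = {m}ᶜ := by
  constructor
  · intro h
    have : Sᶜ.card = 1 := by
      rw [Finset.card_compl, h, Fintype.card_fin]
      have := NeZero.pos k
      omega
    obtain ⟨m, hm⟩ := Finset.card_eq_one.1 this
    exact ⟨m, by rw [← hm, compl_compl]⟩
  · rintro ⟨m, rfl⟩
    simp [Finset.card_compl]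

/-- In a tree the invariant `α(·, S)` is constant, but each missing `x` is its value at `x - 1`;
hence just one element is missing. Conversely, all arcs are then `i → i - 1`. -/
theorem reachesLast_gammaMap_iff {S : Finset (Fin k)} (hS : S ≠ Finset.univ) :
    (∀ v, ReachesLast (fun i => gammaMap (inclVertex i) S) v) ↔ S.card = k - 1 := by
  rw [card_eq_pred_iff]
  constructor
  · intro h
    refine ⟨alphaMap (lastVertex k) S, ?_⟩
    have hconst : ∀ v, alphaMap v S = alphaMap (lastVertex k) S := fun v =>
      (h v).eq_of_invariant (g := fun v => alphaMap v S) fun i => alphaMap_gammaMap hS _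
    ext x
    rw [Finset.mem_compl, Finset.mem_singleton]
    refine ⟨fun hx e => (alphaMap_spec (lastVertex k) hS).1 (e ▸ hx), fun hx => ?_⟩
    by_contra hxS
    exact hx (by rw [← hconst (x - 1), alphaMap_sub_one_of_notMem hS hxS])
  · rintro ⟨m, rfl⟩
    refine reachesLast_of_sub_one fun i => ?_
    by_cases hi : inclVertex i ∈ ({m}ᶜ : Finset (Fin k))
    · exact gammaMap_of_mem hS hi
    · rw [gammaMap_of_notMem hS hi, alphaMap_compl_singleton]
      congr 1
      simpa [eq_comm] using hi

end SingleSet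

/-! ### Counting tuples by their first set -/

section Counting

variable {k r : ℕ}

theorem mem_tuplesM_iff {p : Fin k → ℤ} {S : Fin r → Finset (Fin k)} :
    S ∈ tuplesM p r ↔ (∀ j, ((Finset.univ.filter fun t => j ∈ S t).card : ℤ) = p j) ∧
      ∀ t, S t ≠ Finset.univ := by
  rw [tuplesM, Finset.mem_filter, mem_tuplesS_iff]

theorem comp_perm_mem_tuplesM {p : Fin k → ℤ} {S : Fin r → Finset (Fin k)}
    (hS : S ∈ tuplesM p r) (σ : Equiv.Perm (Fin r)) : S ∘ σ ∈ tuplesM p r := by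
  rw [mem_tuplesM_iff] at hS ⊢
  refine ⟨fun j => ?_, fun t => hS.2 _⟩
  rw [← hS.1 j, Nat.cast_inj]
  exact Finset.card_equiv σ (by simp)

theorem card_filter_mem_tuplesM (p : Fin k → ℤ) (j : Fin k) (t u : Fin r) :
    ((tuplesM p r).filter fun S => j ∈ S t).card =
      ((tuplesM p r).filter fun S => j ∈ S u).card := by
  refine Finset.card_nbij' (fun S => S ∘ Equiv.swap t u) (fun S => S ∘ Equiv.swap t u) ?_ ?_ ?_ ?_
  · intro S hS
    simp only [Finset.coe_filter, Set.mem_ofPred_eq] at hS ⊢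
    exact ⟨comp_perm_mem_tuplesM hS.1 _, by simpa using hS.2⟩
  · intro S hS
    simp only [Finset.coe_filter, Set.mem_ofPred_eq] at hS ⊢
    exact ⟨comp_perm_mem_tuplesM hS.1 _, by simpa using hS.2⟩
  · intro S _
    ext; simp
  · intro S _
    ext; simp

/-- Double counting of incidences of `j`, with all positions equivalent under permutation. -/
theorem mul_card_filter_mem_tuplesM (p : Fin k → ℕ) (j : Fin k) (t : Fin r) :
    r * ((tuplesM (fun j => (p j : ℤ)) r).filter fun S => j ∈ S t).card =
      p j * (tuplesM (fun j => (p j : ℤ)) r).card := by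
  calc _ = ∑ u : Fin r, ((tuplesM (fun j => (p j : ℤ)) r).filter fun S => j ∈ S u).card := by
        rw [Finset.sum_congr rfl fun u _ => card_filter_mem_tuplesM _ j u t]
        simp
    _ = ∑ S ∈ tuplesM (fun j => (p j : ℤ)) r, (Finset.univ.filter fun u => j ∈ S u).card := by
        simp only [Finset.card_filter]
        exact Finset.sum_comm
    _ = ∑ S ∈ tuplesM (fun j => (p j : ℤ)) r, p j := by
        refine Finset.sum_congr rfl fun S hS => ?_
        exact_mod_cast (mem_tuplesM_iff.1 hS).1 j
    _ = _ := by rw [Finset.sum_const, smul_eq_mul, mul_comm]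

theorem card_filter_notMem_div {p : Fin k → ℕ} (hM : (tuplesM (fun j => (p j : ℤ)) r).Nonempty)
    (j : Fin k) (t : Fin r) :
    (((tuplesM (fun j => (p j : ℤ)) r).filter fun S => j ∉ S t).card : ℝ) /
      (tuplesM (fun j => (p j : ℤ)) r).card = 1 - (p j : ℝ) / r := by
  have h1 := mul_card_filter_mem_tuplesM p j t
  have h2 := Finset.card_filter_add_card_filter_not (s := tuplesM (fun j => (p j : ℤ)) r)
    (fun S => j ∈ S t)
  have hc : ((tuplesM (fun j => (p j : ℤ)) r).card : ℝ) ≠ 0 := by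
    exact_mod_cast (Finset.card_pos.2 hM).ne'
  have hr : (r : ℝ) ≠ 0 := by exact_mod_cast (Fin.pos t).ne'
  have h1' : (r : ℝ) * ((tuplesM (fun j => (p j : ℤ)) r).filter fun S => j ∈ S t).card =
      p j * (tuplesM (fun j => (p j : ℤ)) r).card := by exact_mod_cast h1
  have h2' : (((tuplesM (fun j => (p j : ℤ)) r).filter fun S => j ∈ S t).card : ℝ) +
      ((tuplesM (fun j => (p j : ℤ)) r).filter fun S => j ∉ S t).card =
      (tuplesM (fun j => (p j : ℤ)) r).card := by exact_mod_cast h2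
  field_simp
  linear_combination (r : ℝ) * h2' - h1'

theorem cons_compl_mem_tuplesM_iff [NeZero k] (p : Fin k → ℤ) (m : Fin k)
    (S : Fin r → Finset (Fin k)) :
    (Fin.cons {m}ᶜ S : Fin (r + 1) → Finset (Fin k)) ∈ tuplesM p (r + 1) ↔
      S ∈ tuplesM (decreaseExcept p m) r := by
  simp only [mem_tuplesM_iff, Fin.card_filter_univ_succ, Fin.forall_fin_succ, Fin.cons_zero,
    Fin.cons_succ]
  refine and_congr (forall_congr' fun j => ?_) (and_iff_right (compl_singleton_ne_univ m))
  by_cases hj : j = m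
  · simp [decreaseExcept, hj]
  · simp only [decreaseExcept, hj, Finset.mem_compl, Finset.mem_singleton, not_false_eq_true,
      if_true, if_false]
    push_cast
    constructor <;> intro h <;> linarith

/-- Deleting the first set `{m}ᶜ` lowers every multiplicity by one except that of `m`. -/
theorem card_filter_eq_compl_singleton [NeZero k] (hr : 0 < r) (p : Fin k → ℤ) (m : Fin k) :
    ((tuplesM p r).filter fun S => S ⟨0, hr⟩ = {m}ᶜ).card =
      (tuplesM (decreaseExcept p m) (r - 1)).card := by
  obtain ⟨s, rfl⟩ : ∃ s, r = s + 1 := ⟨r - 1, by omega⟩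
  rw [Nat.add_sub_cancel]
  have hcons : ∀ S : Fin (s + 1) → Finset (Fin k), S ⟨0, hr⟩ = {m}ᶜ →
      (Fin.cons {m}ᶜ (Fin.tail S) : Fin (s + 1) → Finset (Fin k)) = S := by
    intro S hS
    rw [← hS]
    exact Fin.cons_self_tail S
  refine Finset.card_nbij' Fin.tail (fun S => Fin.cons {m}ᶜ S) ?_ ?_ ?_ ?_
  · intro S hS
    simp only [Finset.coe_filter, Set.mem_ofPred_eq, Finset.mem_coe] at hS ⊢
    rw [← cons_compl_mem_tuplesM_iff, hcons S hS.2]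
    exact hS.1
  · intro S hS
    simp only [Finset.coe_filter, Set.mem_ofPred_eq, Finset.mem_coe] at hS ⊢
    exact ⟨(cons_compl_mem_tuplesM_iff _ _ _).2 hS, rfl⟩
  · intro S hS
    simp only [Finset.coe_filter, Set.mem_ofPred_eq] at hS
    exact hcons S hS.2
  · intro S _
    exact Fin.tail_cons _ _

theorem card_filter_card_eq [NeZero k] (hr : 0 < r) (p : Fin k → ℤ) :
    ((tuplesM p r).filter fun S => (S ⟨0, hr⟩).card = k - 1).card =
      ∑ j, (tuplesM (decreaseExcept p j) (r - 1)).card := by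
  simp only [← card_filter_eq_compl_singleton hr]
  rw [← Finset.card_biUnion]
  · congr 1
    ext S
    simp [card_eq_pred_iff]
  · intro i _ j _ hij
    refine Finset.disjoint_filter.2 fun S _ h1 h2 => hij ?_
    simpa using h1.symm.trans h2

end Counting

/-! ### From counts to probabilities -/

section Probability

open Classical in
theorem measure_eq_of_hasLaw_uniformOn {Ω X : Type*} [MeasurableSpace Ω] [MeasurableSpace X]
    [MeasurableSingletonClass X] {P : Measure Ω} {f : Ω → X} {s : Finset X} [Finite X]
    (hf : HasLaw f (uniformOn (s : Set X)) P) (A : X → Prop) :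
    P {ω | A (f ω)} = ((s.filter A).card : ENNReal) / s.card := by
  have h1 : P {ω | A (f ω)} = P.map f {x | A x} :=
    (Measure.map_apply_of_aemeasurable hf.aemeasurable (Set.toFinite _).measurableSet).symm
  have h2 : (s : Set X) ∩ {x | A x} = (s.filter A : Finset X) := by
    ext; simp
  rw [h1, hf.map_eq, uniformOn, cond_apply s.measurableSet, h2, Measure.count_apply_finset,
    Measure.count_apply_finset, ENNReal.div_eq_inv_mul]

open Classical in
/-- If the number of favourable values of a uniform variable does not depend on an independent
second variable, it determines the joint probability. -/
theorem real_joint_eq_of_card_eq {Ω X Y : Type*} [MeasurableSpace Ω] [MeasurableSpace X]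
    [MeasurableSingletonClass X] [Finite X] [MeasurableSpace Y] [MeasurableSingletonClass Y]
    [Finite Y] {P : Measure Ω} [IsProbabilityMeasure P] {f : Ω → X} {g : Ω → Y} {s : Finset X}
    (hf : HasLaw f (uniformOn (s : Set X)) P) (hg : AEMeasurable g P) (hind : IndepFun f g P)
    (E : X → Y → Prop) {N : ℕ} (hN : ∀ y, (s.filter fun x => E x y).card = N) :
    P.real {ω | E (f ω) (g ω)} = (N : ℝ) / s.card := by
  have hfg := (indepFun_iff_map_prod_eq_prod_map_map hf.aemeasurable hg).1 hind
  have h1 : P {ω | E (f ω) (g ω)} = P.map (fun ω => (f ω, g ω)) {z | E z.1 z.2} :=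
    (Measure.map_apply_of_aemeasurable (s := {z | E z.1 z.2}) (hf.aemeasurable.prodMk hg)
      (Set.toFinite _).measurableSet).symm
  have := Measure.isProbabilityMeasure_map (μ := P) hf.aemeasurable
  have := Measure.isProbabilityMeasure_map (μ := P) hg
  have h2 : ∀ y, P.map f ((fun x => (x, y)) ⁻¹' {z | E z.1 z.2}) = (N : ENNReal) / s.card := by
    intro y
    rw [← hN y, ← measure_eq_of_hasLaw_uniformOn hf]
    exact Measure.map_apply_of_aemeasurable hf.aemeasurable (Set.toFinite _).measurableSet
  -- By Fubini, the section at each `y` has the same measure, so the law of `g` integrates to one.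
  rw [measureReal_def, h1, hfg, Measure.prod_apply_symm (Set.toFinite _).measurableSet]
  simp only [h2, lintegral_const, measure_univ, mul_one]
  simp

end Probability

section Trees

variable {k r : ℕ} [NeZero k]

open Classical in
/-- With independent uniform sets and an arbitrary random assignment of sets to vertices, the
probability of a tree is governed by the first set alone. -/
theorem real_isDirectedTree_eq (hr : 0 < r) (hk : 1 < k) {p : Fin k → ℕ}
    {ζ : Fin k → Finset (Fin k) → Fin k} (hζ : IsCyclicallyLinear ζ) {A : Finset (Fin k) → Prop}
    (hA : ∀ S, S ≠ Finset.univ → ((∀ v, ReachesLast (fun i => ζ (inclVertex i) S) v) ↔ A S))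
    {Ω : Type*} [MeasurableSpace Ω] {P : Measure Ω} [IsProbabilityMeasure P]
    {S : Ω → Fin r → Finset (Fin k)} {φ : Ω → Fin (k - 1) → Fin r}
    (hS : HasLaw S
      (uniformOn (tuplesM (fun j => (p j : ℤ)) r : Set (Fin r → Finset (Fin k)))) P)
    (hφ : AEMeasurable φ P) (hind : IndepFun S φ P) :
    P.real {ω | IsDirectedTree (arcDigraph ζ (S ω) (φ ω))} =
      (((tuplesM (fun j => (p j : ℤ)) r).filter fun S => A (S ⟨0, hr⟩)).card : ℝ) /
        (tuplesM (fun j => (p j : ℤ)) r).card := by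
  refine real_joint_eq_of_card_eq hS hφ hind
    (fun S φ => IsDirectedTree (arcDigraph ζ S φ)) fun f => ?_
  -- The comparison assignment is constant and need not be surjective; it sends every vertex to the
  -- first set.
  rw [card_isDirectedTree_eq hk hζ p f fun _ => ⟨0, hr⟩]
  congr 1
  refine Finset.filter_congr fun T hT => ?_
  rw [isDirectedTree_arcDigraph_iff, hA _ ((mem_tuplesM_iff.1 hT).2 _)]

open Classical in
theorem real_first_eq {n : ℕ} (hr : 0 < r) {p : Fin n → ℕ} (A : Finset (Fin n) → Prop)
    {Ω : Type*} [MeasurableSpace Ω] {P : Measure Ω} {S : Ω → Fin r → Finset (Fin n)}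
    (hS : HasLaw S
      (uniformOn (tuplesM (fun j => (p j : ℤ)) r : Set (Fin r → Finset (Fin n)))) P) :
    P.real {ω | A (S ω ⟨0, hr⟩)} =
      (((tuplesM (fun j => (p j : ℤ)) r).filter fun S => A (S ⟨0, hr⟩)).card : ℝ) /
        (tuplesM (fun j => (p j : ℤ)) r).card := by
  rw [measureReal_def, measure_eq_of_hasLaw_uniformOn hS fun S => A (S ⟨0, hr⟩)]
  simp

end Trees

theorem theorem1 (k r : ℕ) [NeZero k] (hr : 0 < r) (hrk : r < k) (p : Fin k → ℕ)
    (hM : (tuplesM (fun j => (p j : ℤ)) r).Nonempty)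
    {Ω : Type*} [MeasurableSpace Ω] (P : Measure Ω) [IsProbabilityMeasure P]
    (S : Ω → Fin r → Finset (Fin k)) (φ : Ω → Fin (k - 1) → Fin r)
    (hS : HasLaw S
      (uniformOn (tuplesM (fun j => (p j : ℤ)) r : Set (Fin r → Finset (Fin k)))) P)
    (hφ : HasLaw φ (uniformOn {f : Fin (k - 1) → Fin r | Function.Surjective f}) P)
    (hind : IndepFun S φ P) :
    (P.real {ω | IsDirectedTree (arcDigraph alphaMap (S ω) (φ ω))} =
        1 - (p (lastVertex k) : ℝ) / r ∧
      P.real {ω | lastVertex k ∉ S ω ⟨0, hr⟩} = 1 - (p (lastVertex k) : ℝ) / r) ∧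
    (P.real {ω | IsDirectedTree (arcDigraph betaMap (S ω) (φ ω))} =
        ((tuplesM (decreaseExcept (fun j => (p j : ℤ)) 0) (r - 1)).card : ℝ) /
          (tuplesM (fun j => (p j : ℤ)) r).card ∧
      P.real {ω | S ω ⟨0, hr⟩ = {(0 : Fin k)}ᶜ} =
        ((tuplesM (decreaseExcept (fun j => (p j : ℤ)) 0) (r - 1)).card : ℝ) /
          (tuplesM (fun j => (p j : ℤ)) r).card) ∧
    (P.real {ω | IsDirectedTree (arcDigraph gammaMap (S ω) (φ ω))} =
        ∑ j : Fin k, ((tuplesM (decreaseExcept (fun j => (p j : ℤ)) j) (r - 1)).card : ℝ) /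
          (tuplesM (fun j => (p j : ℤ)) r).card ∧
      P.real {ω | (S ω ⟨0, hr⟩).card = k - 1} =
        ∑ j : Fin k, ((tuplesM (decreaseExcept (fun j => (p j : ℤ)) j) (r - 1)).card : ℝ) /
          (tuplesM (fun j => (p j : ℤ)) r).card) := by
  have hk : 1 < k := by omega
  have hα := card_filter_notMem_div hM (lastVertex k) ⟨0, hr⟩
  have hβ := card_filter_eq_compl_singleton hr (fun j => (p j : ℤ)) 0
  have hγ := card_filter_card_eq hr (fun j => (p j : ℤ))
  refine ⟨⟨?_, ?_⟩, ⟨?_, ?_⟩, ?_, ?_⟩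
  · rw [real_isDirectedTree_eq hr hk isCyclicallyLinear_alphaMap
      (fun S hS => reachesLast_alphaMap_iff hk hS) hS hφ.aemeasurable hind, ← hα]
    congr!
  · rw [real_first_eq hr (fun S => lastVertex k ∉ S) hS, ← hα]
    congr!
  · rw [real_isDirectedTree_eq hr hk isCyclicallyLinear_betaMap
      (fun S hS => reachesLast_betaMap_iff hS) hS hφ.aemeasurable hind, ← hβ]
    congr!
  · rw [real_first_eq hr (fun S => S = {0}ᶜ) hS, ← hβ]
    congr!
  · rw [real_isDirectedTree_eq hr hk isCyclicallyLinear_gammaMap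
      (fun S hS => reachesLast_gammaMap_iff hS) hS hφ.aemeasurable hind, ← Finset.sum_div,
      ← Nat.cast_sum, ← hγ]
    congr!
  · rw [real_first_eq hr (fun S => S.card = k - 1) hS, ← Finset.sum_div, ← Nat.cast_sum, ← hγ]
    congr!
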